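/- Setting. A network $\Sigma$ consists of $n$ first-order subsystems with scalar states $x_1,\dots,x_n$ and $m$ inputs $u_1,\dots,u_m$, $\dot x=Ax+Bu$, $y=x$, regarded as a structured system: $A\in\mathbb R^{n\times n}$ has zero diagonal, and every other entry of $A$ and every entry of $B\in\mathbb R^{n\times m}$ is either fixed to zero or a free real parameter. Its directed graph $G(\Sigma)$ has the state nodes $x_1,\dots,x_n$, the input nodes $u_1,\dots,u_m$, an edge $x_j\to x_i$ whenever $A_{ij}$ is free, and an edge $u_s\to x_i$ whenever $B_{is}$ is free. A stem is a directed path of distinct nodes from an input node to a state node; a cycle is an elementary directed cycle. $\Sigma$ is input-accessible if every state node is the end of a stem. An input-accessible $\Sigma$ is a Y-network if every set of stems and cycles that covers all state nodes contains two different stems from the same input node, but contains neither a stem and a cycle that intersect at some node, nor two different cycles that intersect at some node, nor two stems from different input nodes that intersect at some node. For orders $\hat n_1,\dots,\hat n_n\ge 2$ and a set $S\subseteq\{1,\dots,n\}$, let $\hat\Sigma_S$ be the structured system in which every subsystem $i\in S$ is replaced by a heterogeneous one of order $\hat n_i$ with state $\hat x_i\in\mathbb R^{\hat n_i}$, while the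 subsystems $i\notin S$ keep order one and zero internal dynamics: the diagonal block $\hat a_i$ of the state matrix $\hat A$ is a free matrix for $i\in S$ and zero for $i\notin S$; the block $\hat a_{ij}$, $i\ne j$, is a free matrix if $A_{ij}$ is free and zero otherwise; the $s$-th column of the $i$-th block of the input matrix $\hat B$ is free if $B_{is}$ is free and zero otherwise; and the $i$-th output is $\hat y_i=\hat c_i\hat x_i$ with $\hat c_i$ a free row vector for $i\in S$ and $\hat c_i=1$ for $i\notin S$. $\hat\Sigma_S$ is structurally output controllable if for some values of the free parameters the matrix $\hat C\,[\hat B\ \ \hat A\hat B\ \cdots\ \hat A^{\hat n-1}\hat B]$ has full row rank $n$, where $\hat n$ is the total number of states of $\hat\Sigma_S$. Theorem. Let $\Sigma$ be a Y-network, let $\mathcal Z$ be a maximum cardinality set of state nodes that can be covered by vertex-disjoint stems in $G(\Sigma)$, let $\hat n_1,\dots,\hat n_n\ge 2$, and let $\hat n_M=\max_i\hat n_i$. Then there are sets $S$ for which $\hat\Sigma_S$ is structurally output controllable, and the minimum cardinality $\hat S_{\min}$ of such a set satisfies $$\frac{n-|\mathcal Z|}{\hat n_M}\ \le\ \hat S_{\min}\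 \le\ n-|\mathcal Z|.$$ Moreover, for every $S$ for which $\hat\Sigma_S$ is structurally output controllable, $|S|\ge (n-|\mathcal Z|)/\hat n_M(S)$, where $\hat n_M(S)$ is the largest order of a subsystem of $\hat\Sigma_S$. -/

import Mathlib

/-- An entry of the matrix of a structured linear system: fixed to `0`, fixed to `1`, or a free
(generic) real parameter. -/
inductive Entry where
  | zero
  | one
  | free

/-- The real numbers that an entry may take in a numerical realization. -/
def Entry.Admits : Entry → ℝ → Prop
  | .zero, r => r = 0
  | .one, r => r = 1
  | .free, _ => True

/-- A structured linear system `x' = A x + B u`, `y = C x` with states indexed by `X`, inputs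
indexed by `U` and outputs indexed by `Y`. -/
structure StructuredSystem (X U Y : Type) where
  A : Matrix X X Entry
  B : Matrix X U Entry
  C : Matrix Y X Entry

/-- The numerical matrix `M` is a realization of the structured matrix `P`. -/
def IsRealization {I J : Type} (P : Matrix I J Entry) (M : Matrix I J ℝ) : Prop :=
  ∀ i j, (P i j).Admits (M i j)

/-- The controllability matrix `[B, A B, …, A ^ (N - 1) B]`, where `N` is the number of states. -/
noncomputable def ctrbMatrix {X U : Type} [Fintype X] [DecidableEq X]
    (A : Matrix X X ℝ) (B : Matrix X U ℝ) : Matrix X (Fin (Fintype.card X) × U) ℝ :=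
  Matrix.of fun x ku => (A ^ (ku.1 : ℕ) * B) x ku.2

namespace StructuredSystem

variable {X U Y : Type}

/-- Some numerical realization has an output controllability matrix `C [B, A B, …]` of full row
rank. -/
def IsStructurallyOutputControllable [Fintype X] [DecidableEq X] [Fintype U] [Fintype Y]
    (σ : StructuredSystem X U Y) : Prop :=
  ∃ (A : Matrix X X ℝ) (B : Matrix X U ℝ) (C : Matrix Y X ℝ),
    IsRealization σ.A A ∧ IsRealization σ.B B ∧ IsRealization σ.C C ∧
      (C * ctrbMatrix A B).rank = Fintype.card Y

/-- The edge relation of the directed graph of a structured system; its nodes are the input nodes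
`Sum.inl s` and the state nodes `Sum.inr x`. -/
def Edge (σ : StructuredSystem X U Y) : U ⊕ X → U ⊕ X → Prop
  | .inl s, .inr x => σ.B x s ≠ Entry.zero
  | .inr x, .inr y => σ.A y x ≠ Entry.zero
  | _, .inl _ => False

/-- `p` is a stem: a directed path of distinct nodes from an input node to a state node. -/
def IsStem (σ : StructuredSystem X U Y) (p : List (U ⊕ X)) : Prop :=
  p.Nodup ∧ p.IsChain σ.Edge ∧
    (∃ s : U, p.head? = some (Sum.inl s)) ∧ ∃ x : X, p.getLast? = some (Sum.inr x)

/-- `c` is an elementary cycle, given by the list of its (distinct) nodes, without repetition of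
the first node at the end; a self-loop is a cycle with one node. -/
def IsElementaryCycle (σ : StructuredSystem X U Y) (c : List (U ⊕ X)) : Prop :=
  ∃ v l, c = v :: l ∧ c.Nodup ∧ (c ++ [v]).IsChain σ.Edge

/-- Every state node is the end vertex of a stem. -/
def IsInputAccessible (σ : StructuredSystem X U Y) : Prop :=
  ∀ x : X, ∃ p, σ.IsStem p ∧ p.getLast? = some (Sum.inr x)

/-- `P` is a set of stems and cycles that covers all state nodes. -/
def IsStemCycleCover (σ : StructuredSystem X U Y) (P : Set (List (U ⊕ X))) : Prop :=
  (∀ p ∈ P, σ.IsStem p ∨ σ.IsElementaryCycle p) ∧ ∀ x : X, ∃ p ∈ P, Sum.inr x ∈ p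

/-- `P` contains a stem and a cycle that intersect at some node. -/
def StemMeetsCycle (σ : StructuredSystem X U Y) (P : Set (List (U ⊕ X))) : Prop :=
  ∃ p ∈ P, ∃ c ∈ P, σ.IsStem p ∧ σ.IsElementaryCycle c ∧ ∃ w, w ∈ p ∧ w ∈ c

/-- `P` contains two different cycles that intersect at some node. Two lists give the same cycle
if they differ by a rotation. -/
def CycleMeetsCycle (σ : StructuredSystem X U Y) (P : Set (List (U ⊕ X))) : Prop :=
  ∃ c ∈ P, ∃ d ∈ P, σ.IsElementaryCycle c ∧ σ.IsElementaryCycle d ∧ ¬ c.IsRotated d ∧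
    ∃ w, w ∈ c ∧ w ∈ d

/-- `P` contains two stems from different input nodes that intersect at some node. -/
def StemMeetsStem (σ : StructuredSystem X U Y) (P : Set (List (U ⊕ X))) : Prop :=
  ∃ p ∈ P, ∃ q ∈ P, σ.IsStem p ∧ σ.IsStem q ∧ p.head? ≠ q.head? ∧ ∃ w, w ∈ p ∧ w ∈ q

/-- `P` contains two different stems from the same input node. -/
def StemsShareInput (σ : StructuredSystem X U Y) (P : Set (List (U ⊕ X))) : Prop :=
  ∃ p ∈ P, ∃ q ∈ P, σ.IsStem p ∧ σ.IsStem q ∧ p ≠ q ∧ p.head? = q.head?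

/-- The set `Z` of state nodes can be covered by vertex-disjoint stems. -/
def CoveredByDisjointStems (σ : StructuredSystem X U Y) (Z : Finset X) : Prop :=
  ∃ P : Set (List (U ⊕ X)), (∀ p ∈ P, σ.IsStem p) ∧ P.Pairwise List.Disjoint ∧
    ∀ z ∈ Z, ∃ p ∈ P, Sum.inr z ∈ p

/-- `Z` is a set of state nodes of maximum cardinality among those that can be covered by
vertex-disjoint stems. -/
def IsMaximumStemCovered (σ : StructuredSystem X U Y) (Z : Finset X) : Prop :=
  σ.CoveredByDisjointStems Z ∧ ∀ Z' : Finset X, σ.CoveredByDisjointStems Z' → Z'.card ≤ Z.card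

end StructuredSystem

/-- The interconnection structure of a network of `n` identical first-order subsystems with trivial
internal dynamics and `m` external inputs: `edge j i` says that subsystem `j` acts on subsystem `i`
(the weight `a i j` is a free parameter), and `input s i` says that input `s` acts on subsystem `i`
(the entry `(i, s)` of the input matrix is a free parameter). All other entries are zero. -/
structure Network (n m : ℕ) where
  edge : Fin n → Fin n → Prop
  input : Fin m → Fin n → Prop
  loopless : ∀ i, ¬ edge i i

namespace Network

variable {n m : ℕ}

open Classical in
/-- The network as a structured system with one state per subsystem and output matrix the
identity. -/
noncomputable def system (G : Network n m) : StructuredSystem (Fin n) (Fin m) (Fin n) where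
  A := Matrix.of fun i j => if G.edge j i then Entry.free else Entry.zero
  B := Matrix.of fun i s => if G.input s i then Entry.free else Entry.zero
  C := Matrix.of fun i j => if i = j then Entry.one else Entry.zero

/-- An input-accessible network is a Y-network if every set of stems and cycles covering the state
nodes contains two different stems from the same input node, but no stem meeting a cycle, no two
different cycles that meet, and no two stems from different inputs that meet. -/
def IsYNetwork (G : Network n m) : Prop :=
  G.system.IsInputAccessible ∧
    ∀ P, G.system.IsStemCycleCover P →
      G.system.StemsShareInput P ∧ ¬ G.system.StemMeetsCycle P ∧
        ¬ G.system.CycleMeetsCycle P ∧ ¬ G.system.StemMeetsStem P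

/-- The orders of the subsystems if exactly the subsystems in `S` are replaced, subsystem `i ∈ S`
by one of order `ν i`, and all other subsystems are kept as first-order ones. -/
def orders (ν : Fin n → ℕ) (S : Finset (Fin n)) (i : Fin n) : ℕ :=
  if i ∈ S then ν i else 1

open Classical in
/-- The extended system in which subsystem `i` has order `d i`, the subsystems in `H` have
heterogeneous (generic) internal dynamics and the others trivial (zero) internal dynamics. An
off-diagonal block of the state matrix, or a column of a block of the input matrix, is generic
where the corresponding entry of the original network is free, and zero elsewhere. The `i`-th
output is a generic linear combination of the states of subsystem `i`, or its state itself if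
the order is one. -/
noncomputable def extended (G : Network n m) (d : Fin n → ℕ) (H : Finset (Fin n)) :
    StructuredSystem (Σ i : Fin n, Fin (d i)) (Fin m) (Fin n) where
  A := Matrix.of fun x y =>
    if x.1 = y.1 then (if x.1 ∈ H then Entry.free else Entry.zero)
    else if G.edge y.1 x.1 then Entry.free else Entry.zero
  B := Matrix.of fun x s => if G.input s x.1 then Entry.free else Entry.zero
  C := Matrix.of fun i x =>
    if i = x.1 then (if d i = 1 then Entry.one else Entry.free) else Entry.zero

/-- Structural output controllability is obtained by replacing exactly the subsystems in `S` by
heterogeneous ones, subsystem `i ∈ S` by one of order `ν i`. -/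
def ControllableAfterReplacing (G : Network n m) (ν : Fin n → ℕ) (S : Finset (Fin n)) : Prop :=
  (G.extended (orders ν S) S).IsStructurallyOutputControllable

end Network

/-! Applied to the family of all stems and cycles, the Y-condition says that no stem meets a cycle
and that stems from different inputs are disjoint. With accessibility, the graph is acyclic and its
state nodes split into classes, one per input, with no edge between different classes.

Lower bound: fix `S`, and let `L s` be the largest number of nodes outside `S` on a stem from input
`s`. Grading the states in the class of `s` by such counts makes `A` block triangular. Nodes outside
`S` give at most `L s` blocks, all zero; the other blocks consist of states of subsystems in `S`.
The factor `X` for each zero block and the characteristic polynomial for each other block multiply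
to a polynomial that annihilates column `s` of `B` (`exists_annihilator`). Its degree bounds the
contribution of `s` to the rank. Optimal stems of different inputs are disjoint, so the `L s` sum to
at most `|Z|`, and `n ≤ |Z| + ∑ i ∈ S, d i` (`le_card_add_sum`).

Upper bound: `S = Zᶜ` works, and one active state per subsystem suffices. Inside `Z` the stems act
as shifts, so a node responds to its own input at exactly one time, its position. Outside `Z`,
self-loops with well separated weights, increasing along edges, give every node its own exponential
growth rate. A linear relation between the responses loses its coefficients outside `Z` by growth,
the fastest first, and then those on `Z` by timing (`eq_zero_of_sum_mul_pathMatrix_pow`). -/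

namespace Network

variable {n m : ℕ} {G : Network n m}

/-! ### Acyclicity and root inputs of Y-networks -/

lemma system_edge_inl {s : Fin m} {x : Fin n} :
    G.system.Edge (.inl s) (.inr x) ↔ G.input s x := by
  simp [StructuredSystem.Edge, system]

lemma system_edge_inr {x y : Fin n} : G.system.Edge (.inr x) (.inr y) ↔ G.edge x y := by
  simp [StructuredSystem.Edge, system]

lemma not_system_edge_to_inl {v : Fin m ⊕ Fin n} {s : Fin m} : ¬ G.system.Edge v (.inl s) := by
  cases v <;> simp [StructuredSystem.Edge]

/-- The stems and elementary cycles of a Y-network cover its state nodes. -/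
lemma IsYNetwork.allCover (hG : G.IsYNetwork) :
    G.system.IsStemCycleCover {p | G.system.IsStem p ∨ G.system.IsElementaryCycle p} := by
  refine ⟨fun p hp => hp, fun x => ?_⟩
  obtain ⟨p, hp, hx⟩ := hG.1 x
  exact ⟨p, Or.inl hp, List.mem_of_getLast? hx⟩

lemma IsYNetwork.stem_disjoint_cycle (hG : G.IsYNetwork) {p c : List (Fin m ⊕ Fin n)}
    (hp : G.system.IsStem p) (hc : G.system.IsElementaryCycle c) {w : Fin m ⊕ Fin n}
    (hwp : w ∈ p) : w ∉ c := fun hwc =>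
  (hG.2 _ hG.allCover).2.1 ⟨p, Or.inl hp, c, Or.inr hc, hp, hc, w, hwp, hwc⟩

lemma IsYNetwork.head_eq_of_mem (hG : G.IsYNetwork) {p q : List (Fin m ⊕ Fin n)}
    (hp : G.system.IsStem p) (hq : G.system.IsStem q) {w : Fin m ⊕ Fin n}
    (hwp : w ∈ p) (hwq : w ∈ q) : p.head? = q.head? := by
  by_contra h
  exact (hG.2 _ hG.allCover).2.2.2 ⟨p, Or.inl hp, q, Or.inl hq, hp, hq, h, w, hwp, hwq⟩

/-- Otherwise the part of the stem from `i` to `j`, closed by the edge, would be a cycle meeting the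
stem. -/
lemma IsYNetwork.notMem_stem_of_edge (hG : G.IsYNetwork) {p : List (Fin m ⊕ Fin n)}
    (hp : G.system.IsStem p) {i j : Fin n} (hj : p.getLast? = some (.inr j)) (hji : G.edge j i) :
    (Sum.inr i : Fin m ⊕ Fin n) ∉ p := by
  intro hi
  obtain ⟨a, b, rfl⟩ := List.append_of_mem hi
  have hc : G.system.IsElementaryCycle (.inr i :: b) := by
    refine ⟨.inr i, b, rfl, (List.nodup_append.1 hp.1).2.1, ?_⟩
    rw [List.isChain_append]
    refine ⟨(List.isChain_append.1 hp.2.1).2.1, by simp, ?_⟩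
    intro x hx y hy
    rw [List.getLast?_append_of_ne_nil _ (by simp)] at hj
    rw [hj] at hx
    simp only [Option.mem_def, Option.some.injEq, List.head?_cons] at hx hy
    subst hx hy
    exact system_edge_inr.2 hji
  exact hG.stem_disjoint_cycle hp hc hi (by simp)

lemma IsYNetwork.isStem_append (hG : G.IsYNetwork) {p : List (Fin m ⊕ Fin n)}
    (hp : G.system.IsStem p) {i j : Fin n} (hj : p.getLast? = some (.inr j)) (hji : G.edge j i) :
    G.system.IsStem (p ++ [.inr i]) := by
  refine ⟨?_, ?_, ?_, i, by simp⟩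
  · have := hG.notMem_stem_of_edge hp hj hji
    simp only [List.nodup_append, List.nodup_cons, List.not_mem_nil, not_false_eq_true,
      List.nodup_nil, and_self, List.mem_cons, or_false, true_and]
    refine ⟨hp.1, ?_⟩
    rintro a ha b rfl rfl
    exact this ha
  · rw [List.isChain_append]
    refine ⟨hp.2.1, by simp, ?_⟩
    intro x hx y hy
    rw [hj] at hx
    simp only [Option.mem_def, Option.some.injEq, List.head?_cons] at hx hy
    subst hx hy
    exact system_edge_inr.2 hji
  · obtain ⟨s, hs⟩ := hp.2.2.1
    exact ⟨s, by simp [hs]⟩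

lemma isStem_pair {s : Fin m} {i : Fin n} (h : G.input s i) :
    G.system.IsStem [.inl s, .inr i] :=
  ⟨by simp, by simp [system_edge_inl.2 h], ⟨s, rfl⟩, i, rfl⟩

/-- In a Y-network every state node has a unique input node from which it can be reached. -/
lemma IsYNetwork.exists_root (hG : G.IsYNetwork) :
    ∃ r : Fin n → Fin m, ∀ p, G.system.IsStem p → ∀ i, (Sum.inr i : Fin m ⊕ Fin n) ∈ p →
      p.head? = some (.inl (r i)) := by
  have h : ∀ i, ∃ s : Fin m, ∀ p, G.system.IsStem p → (Sum.inr i : Fin m ⊕ Fin n) ∈ p →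
      p.head? = some (.inl s) := by
    intro i
    obtain ⟨q, hq, hi⟩ := hG.1 i
    obtain ⟨s, hs⟩ := hq.2.2.1
    exact ⟨s, fun p hp hip => by
      rw [← hs]; exact hG.head_eq_of_mem hp hq hip (List.mem_of_getLast? hi)⟩
  choose r hr using h
  exact ⟨r, fun p hp i => hr i p hp⟩

/-! ### Weighted heights and disjoint stems -/

open Classical in
/-- The total weight of the state nodes on a list of nodes. -/
noncomputable def stemWeight (w : Fin n → ℕ) (p : List (Fin m ⊕ Fin n)) : ℕ :=
  ∑ z : Fin n with (Sum.inr z : Fin m ⊕ Fin n) ∈ p, w z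

/-- The largest weight of a stem that ends at a given state node. -/
noncomputable def height (G : Network n m) (w : Fin n → ℕ) (i : Fin n) : ℕ :=
  sSup {k | ∃ p, G.system.IsStem p ∧ p.getLast? = some (.inr i) ∧ stemWeight w p = k}

lemma bddAbove_stemWeight (w : Fin n → ℕ) (i : Fin n) :
    BddAbove {k | ∃ p, G.system.IsStem p ∧ p.getLast? = some (.inr i) ∧ stemWeight w p = k} := by
  refine ⟨∑ z, w z, ?_⟩
  rintro k ⟨p, -, -, rfl⟩
  classical exact Finset.sum_le_sum_of_subset (Finset.filter_subset _ _)

lemma stemWeight_le_height {w : Fin n → ℕ} {p : List (Fin m ⊕ Fin n)} (hp : G.system.IsStem p)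
    {i : Fin n} (hi : p.getLast? = some (.inr i)) : stemWeight w p ≤ G.height w i :=
  le_csSup (bddAbove_stemWeight w i) ⟨p, hp, hi, rfl⟩

lemma IsYNetwork.exists_stem_height (hG : G.IsYNetwork) (w : Fin n → ℕ) (i : Fin n) :
    ∃ p, G.system.IsStem p ∧ p.getLast? = some (.inr i) ∧ stemWeight w p = G.height w i := by
  refine Nat.sSup_mem ?_ (bddAbove_stemWeight w i)
  obtain ⟨p, hp, hi⟩ := hG.1 i
  exact ⟨_, p, hp, hi, rfl⟩

/-- An optimal stem to `j` can be prolonged by `i`, which is a new node on it and so adds its full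
weight. -/
lemma IsYNetwork.height_add_le (hG : G.IsYNetwork) (w : Fin n → ℕ) {i j : Fin n}
    (h : G.edge j i) : G.height w j + w i ≤ G.height w i := by
  classical
  obtain ⟨p, hp, hj, hw⟩ := hG.exists_stem_height w j
  have hi := hG.notMem_stem_of_edge hp hj h
  refine le_trans (le_of_eq ?_)
    (stemWeight_le_height (w := w) (hG.isStem_append hp hj h) (i := i) (by simp))
  rw [← hw, stemWeight, stemWeight]
  have : (Finset.univ.filter fun z : Fin n => (Sum.inr z : Fin m ⊕ Fin n) ∈ p ++ [.inr i]) =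
      insert i (Finset.univ.filter fun z : Fin n => (Sum.inr z : Fin m ⊕ Fin n) ∈ p) := by
    ext z; simp [or_comm]
  rw [this, Finset.sum_insert (by simpa using hi), add_comm]

lemma IsYNetwork.le_height (hG : G.IsYNetwork) (w : Fin n → ℕ) (i : Fin n) :
    w i ≤ G.height w i := by
  classical
  obtain ⟨p, hp, hi⟩ := hG.1 i
  refine le_trans ?_ (stemWeight_le_height (w := w) hp hi)
  exact Finset.single_le_sum (f := w) (fun _ _ => Nat.zero_le _)
    (by simpa using List.mem_of_getLast? hi)

lemma IsYNetwork.exists_predecessor (hG : G.IsYNetwork) (i : Fin n) :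
    (∃ s, G.input s i) ∨ ∃ j, G.edge j i := by
  obtain ⟨p, hp, hi⟩ := hG.1 i
  obtain ⟨s, hs⟩ := hp.2.2.1
  obtain ⟨l, rfl⟩ := List.getLast?_eq_some_iff.1 hi
  have hc := List.isChain_append.1 hp.2.1
  rcases hl : l.getLast? with _ | v
  · rw [List.getLast?_eq_none_iff] at hl
    subst hl
    simp at hs
  · have := hc.2.2 v hl (.inr i) (by simp)
    cases v with
    | inl s => exact Or.inl ⟨s, system_edge_inl.1 this⟩
    | inr j => exact Or.inr ⟨j, system_edge_inr.1 this⟩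

open Classical in
/-- The sum over the inputs of the largest number of nodes outside `S` on a stem is a lower bound
for the size of a maximum set covered by disjoint stems. -/
lemma IsYNetwork.sum_sup_height_le (hG : G.IsYNetwork) {Z : Finset (Fin n)}
    (hZ : G.system.IsMaximumStemCovered Z) {r : Fin n → Fin m}
    (hr : ∀ p, G.system.IsStem p → ∀ i, (Sum.inr i : Fin m ⊕ Fin n) ∈ p →
      p.head? = some (.inl (r i))) (S : Finset (Fin n)) :
    ∑ s, (Finset.univ.filter (r · = s)).sup (G.height fun i => if i ∈ S then 0 else 1) ≤
      Z.card := by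
  set w : Fin n → ℕ := fun i => if i ∈ S then 0 else 1 with hw
  have key : ∀ s : Fin m, ∃ p : List (Fin m ⊕ Fin n),
      (G.system.IsStem p → p.head? = some (.inl s)) ∧
      (Finset.univ.filter (r · = s)).sup (G.height w) ≤
        (Finset.univ.filter fun z => z ∉ S ∧ G.system.IsStem p ∧ Sum.inr z ∈ p).card := by
    intro s
    rcases (Finset.univ.filter (r · = s)).eq_empty_or_nonempty with h | h
    · refine ⟨[], fun h => ?_, by simp [h]⟩
      obtain ⟨s, hs⟩ := h.2.2.1
      simp at hs
    · obtain ⟨i, hi, hsup⟩ := Finset.exists_mem_eq_sup _ h (G.height w)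
      obtain ⟨p, hp, hl, hpw⟩ := hG.exists_stem_height w i
      refine ⟨p, fun _ => ?_, ?_⟩
      · rw [hr p hp i (List.mem_of_getLast? hl), (Finset.mem_filter.1 hi).2]
      · rw [hsup, ← hpw, stemWeight, Finset.card_filter, Finset.sum_filter]
        refine Finset.sum_le_sum fun z _ => ?_
        by_cases h1 : z ∈ S <;> by_cases h2 : (Sum.inr z : Fin m ⊕ Fin n) ∈ p <;>
          simp [hw, h1, h2, hp]
  choose f hf hcard using key
  refine (Finset.sum_le_sum fun s _ => hcard s).trans ?_
  rw [← Finset.card_biUnion]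
  · refine hZ.2 _ ⟨{p | G.system.IsStem p ∧ ∃ s, p = f s}, fun p hp => hp.1, ?_, ?_⟩
    · rintro _ ⟨hp, s, rfl⟩ _ ⟨hq, t, rfl⟩ hne
      rw [List.disjoint_left]
      intro a ha hb
      have := hG.head_eq_of_mem hp hq ha hb
      rw [hf s hp, hf t hq] at this
      simp only [Option.some.injEq, Sum.inl.injEq] at this
      exact hne (by rw [this])
    · intro z hz
      simp only [Finset.mem_biUnion, Finset.mem_univ, Finset.mem_filter, true_and] at hz
      obtain ⟨s, -, hp, hz⟩ := hz
      exact ⟨f s, ⟨hp, s, rfl⟩, hz⟩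
  · intro s _ t _ hst
    rw [Function.onFun, Finset.disjoint_left]
    intro z hz hz'
    simp only [Finset.mem_filter, Finset.mem_univ, true_and] at hz hz'
    have := hG.head_eq_of_mem hz.2.1 hz'.2.1 hz.2.2 hz'.2.2
    rw [hf s hz.2.1, hf t hz'.2.1] at this
    simp only [Option.some.injEq, Sum.inl.injEq] at this
    exact hst this

/-- The nodes of a maximum set covered by disjoint stems are determined by their stem, given by its
input node, and their position on it. -/
lemma exists_stem_position {Z : Finset (Fin n)}
    (hZ : G.system.IsMaximumStemCovered Z) {r : Fin n → Fin m}
    (hr : ∀ p, G.system.IsStem p → ∀ i, (Sum.inr i : Fin m ⊕ Fin n) ∈ p →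
      p.head? = some (.inl (r i))) :
    ∃ t : Fin n → ℕ, (∀ i ∈ Z, ∀ j ∈ Z, r i = r j → t i = t j → i = j) ∧
      (∀ j ∈ Z, t j = 0 → G.input (r j) j) ∧
      ∀ j ∈ Z, ∀ k, t j = k + 1 → ∃ i ∈ Z, r i = r j ∧ t i = k ∧ G.edge i j := by
  classical
  obtain ⟨⟨P, hP, hdisj, hcov⟩, hmax⟩ := hZ
  -- By maximality, the chosen stems cover no state node beyond `Z`.
  have hclosed : ∀ p ∈ P, ∀ z, (Sum.inr z : Fin m ⊕ Fin n) ∈ p → z ∈ Z := by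
    have : Z = Finset.univ.filter fun z => ∃ p ∈ P, (Sum.inr z : Fin m ⊕ Fin n) ∈ p := by
      refine Finset.eq_of_subset_of_card_le (fun z hz => by simpa using hcov z hz) (hmax _ ?_)
      exact ⟨P, hP, hdisj, fun z hz => by simpa using hz⟩
    intro p hp z hz
    rw [this]
    simpa using ⟨p, hp, hz⟩
  have huniq : ∀ p ∈ P, ∀ q ∈ P, ∀ v, v ∈ p → v ∈ q → p = q := by
    intro p hp q hq v hvp hvq
    by_contra hne
    exact List.disjoint_left.1 (hdisj hp hq hne) hvp hvq
  -- Positions are shifted by one because entry `0` of a stem is its input node.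
  have hpos : ∀ j, ∃ (p : List (Fin m ⊕ Fin n)) (t : ℕ), j ∈ Z →
      p ∈ P ∧ p[t + 1]? = some (.inr j) := by
    intro j
    by_cases hj : j ∈ Z
    · obtain ⟨p, hp, hjp⟩ := hcov j hj
      obtain ⟨e, he⟩ := List.getElem?_of_mem hjp
      cases e with
      | zero =>
        obtain ⟨s, hs⟩ := (hP p hp).2.2.1
        rw [List.head?_eq_getElem?, he] at hs
        simp at hs
      | succ t => exact ⟨p, t, fun _ => ⟨hp, he⟩⟩
    · exact ⟨[], 0, fun h => absurd h hj⟩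
  choose p t hpt using hpos
  have hmem : ∀ j ∈ Z, (Sum.inr j : Fin m ⊕ Fin n) ∈ p j := fun j hj =>
    List.mem_of_getElem? (hpt j hj).2
  have hhead : ∀ j ∈ Z, (p j)[0]? = some (.inl (r j)) := fun j hj => by
    rw [← List.head?_eq_getElem?]
    exact hr _ (hP _ (hpt j hj).1) j (hmem j hj)
  have hedge : ∀ j ∈ Z, ∀ k v w, (p j)[k]? = some v → (p j)[k + 1]? = some w →
      G.system.Edge v w := by
    intro j hj k v w hv hw
    obtain ⟨h1, rfl⟩ := List.getElem?_eq_some_iff.1 hv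
    obtain ⟨h2, rfl⟩ := List.getElem?_eq_some_iff.1 hw
    exact List.isChain_iff_getElem.1 (hP _ (hpt j hj).1).2.1 k h2
  refine ⟨t, ?_, ?_, ?_⟩
  · intro i hi j hj hij htij
    have hpp : p i = p j := by
      refine huniq _ (hpt i hi).1 _ (hpt j hj).1 _ (List.mem_of_getElem? (hhead i hi)) ?_
      rw [hij]
      exact List.mem_of_getElem? (hhead j hj)
    have h1 := (hpt i hi).2
    rw [hpp, htij, (hpt j hj).2] at h1
    simpa using h1.symm
  · intro j hj h0
    have h1 := (hpt j hj).2
    rw [h0] at h1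
    exact system_edge_inl.1 (hedge j hj 0 _ _ (hhead j hj) h1)
  · intro j hj k hk
    have h1 := (hpt j hj).2
    rw [hk] at h1
    obtain ⟨hlt, -⟩ := List.getElem?_eq_some_iff.1 h1
    have hv : (p j)[k + 1]? = some ((p j)[k + 1]'(by omega)) := by simp
    have hu : (p j)[k]? = some ((p j)[k]'(by omega)) := by simp
    have hlast := hedge j hj _ _ _ hv h1
    have hprev := hedge j hj _ _ _ hu hv
    rcases h : (p j)[k + 1]'(by omega) with s | i
    · rw [h] at hprev
      exact absurd hprev not_system_edge_to_inl
    · rw [h] at hlast hv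
      have hip : (Sum.inr i : Fin m ⊕ Fin n) ∈ p j := List.mem_of_getElem? hv
      have hi : i ∈ Z := hclosed _ (hpt j hj).1 i hip
      have hpp : p i = p j := huniq _ (hpt i hi).1 _ (hpt j hj).1 _ (hmem i hi) hip
      refine ⟨i, hi, ?_, ?_, system_edge_inr.1 hlast⟩
      · have := hhead i hi
        rw [hpp, hhead j hj] at this
        simpa using this.symm
      · have h2 := (hpt i hi).2
        rw [hpp] at h2
        obtain ⟨hl2, -⟩ := List.getElem?_eq_some_iff.1 h2
        have := (List.getElem?_inj hl2 (hP _ (hpt j hj).1).1).1 (h2.trans hv.symm)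
        omega

end Network

/-! ### Annihilating polynomials and the rank of the controllability matrix -/

section

open Polynomial

variable {ι U : Type} [Fintype ι] [DecidableEq ι]

/-- Vectors supported on `D` form an `A`-invariant subspace, and those among them that vanish on `E`
form an invariant subspace of it. Restriction to `E` passes to the quotient, where `A` acts by its
diagonal block. -/
lemma aeval_mulVec_restrict (A : Matrix ι ι ℝ) (D E : ι → Prop) [DecidablePred E]
    (hD : ∀ x y, A x y ≠ 0 → D y → D x) (hE : ∀ x y, A x y ≠ 0 → D y → E x → E y)
    (p : ℝ[X]) (v : ι → ℝ) (hv : ∀ x, v x ≠ 0 → D x) :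
    (∀ x, (aeval A p).mulVec v x ≠ 0 → D x) ∧
      ∀ x : {x // E x}, (aeval A p).mulVec v x =
        (aeval (A.toSquareBlockProp E) p).mulVec
          (fun y => v y) x := by
  induction p using Polynomial.induction_on generalizing v with
  | C a =>
    simp only [aeval_C, Algebra.algebraMap_eq_smul_one, Matrix.smul_mulVec, Matrix.one_mulVec,
      Pi.smul_apply, smul_eq_mul]
    exact ⟨fun x hx => hv x (right_ne_zero_of_mul hx), fun _ => trivial⟩
  | add p q hp hq =>
    simp only [map_add, Matrix.add_mulVec, Pi.add_apply]
    refine ⟨fun x hx => ?_, fun x => by rw [(hp v hv).2, (hq v hv).2]⟩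
    by_contra hDx
    refine hx ?_
    rw [not_imp_comm.1 ((hp v hv).1 x) hDx, not_imp_comm.1 ((hq v hv).1 x) hDx, add_zero]
  | monomial k a ih =>
    have hAv : ∀ x, A.mulVec v x ≠ 0 → D x := by
      intro x hx
      obtain ⟨y, -, hy⟩ := Finset.exists_ne_zero_of_sum_ne_zero hx
      exact hD x y (left_ne_zero_of_mul hy) (hv y (right_ne_zero_of_mul hy))
    have hres : (fun x : {x // E x} => A.mulVec v x) =
        (A.toSquareBlockProp E).mulVec (fun y => v y) := by
      ext x
      simp only [Matrix.mulVec, dotProduct, Matrix.toSquareBlockProp_def, Matrix.of_apply]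
      rw [← Finset.sum_subtype (Finset.univ.filter E) (by simp) fun y => A x y * v y]
      symm
      refine Finset.sum_subset (Finset.filter_subset _ _) fun y _ hy => ?_
      by_contra hne
      have := hE x y (left_ne_zero_of_mul hne) (hv y (right_ne_zero_of_mul hne)) x.2
      exact hy (by simpa using this)
    have h := ih (A.mulVec v) hAv
    rw [hres] at h
    simpa only [pow_succ, ← mul_assoc, map_mul, aeval_X, ← Matrix.mulVec_mulVec] using h

/-- If a matrix is block triangular with respect to a grading, a product of polynomials that
annihilate the diagonal blocks raises the grading of the support of a vector. -/
lemma aeval_prod_mulVec_support (A : Matrix ι ι ℝ) (D : ι → Prop) [DecidablePred D] (κ : ι → ℕ)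
    (hA : ∀ x y, A x y ≠ 0 → D y → D x ∧ κ y ≤ κ x) (q : ℕ → ℝ[X])
    (hq : ∀ l, aeval (A.toSquareBlockProp fun x => D x ∧ κ x = l) (q l) = 0)
    (v : ι → ℝ) (hv : ∀ x, v x ≠ 0 → D x) (t : ℕ) :
    ∀ x, (aeval A (∏ l ∈ Finset.range t, q l)).mulVec v x ≠ 0 → D x ∧ t ≤ κ x := by
  induction t with
  | zero => simpa using hv
  | succ t ih =>
    rw [Finset.prod_range_succ, mul_comm, map_mul, ← Matrix.mulVec_mulVec]
    -- The states of level at least `t` are invariant, and level `t` is a quotient of them; `q t`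
    -- kills that quotient and so pushes the support to level `t + 1`.
    have h := aeval_mulVec_restrict A (fun x => D x ∧ t ≤ κ x) (fun x => D x ∧ κ x = t)
      (fun x y hxy hy => ⟨(hA x y hxy hy.1).1, hy.2.trans (hA x y hxy hy.1).2⟩)
      (fun x y hxy hy hx => ⟨hy.1, le_antisymm (hx.2 ▸ (hA x y hxy hy.1).2) hy.2⟩) (q t) _ ih
    intro x hx
    have h1 := h.1 x hx
    refine ⟨h1.1, lt_of_le_of_ne h1.2 fun heq => hx ?_⟩
    have h2 := h.2 ⟨x, h1.1, heq.symm⟩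
    rwa [hq, Matrix.zero_mulVec] at h2

/-- The rank of the controllability matrix is at most the sum of the degrees of polynomials that
annihilate the columns of the input matrix. -/
lemma rank_ctrbMatrix_le [Fintype U] (A : Matrix ι ι ℝ) (B : Matrix ι U ℝ) (p : U → ℝ[X])
    (hp : ∀ s, (p s).Monic) (h : ∀ s, (aeval A (p s)).mulVec (B.col s) = 0) :
    (ctrbMatrix A B).rank ≤ ∑ s, (p s).natDegree := by
  set f : (Σ s, Fin (p s).natDegree) → ι → ℝ := fun z => (A ^ (z.2 : ℕ)).mulVec (B.col z.1)
    with hf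
  rw [Matrix.rank_eq_finrank_span_cols]
  have hle : Submodule.span ℝ (Set.range (ctrbMatrix A B).col) ≤
      Submodule.span ℝ (Set.range f) := by
    rw [Submodule.span_le]
    rintro _ ⟨⟨k, s⟩, rfl⟩
    have hcol : (ctrbMatrix A B).col (k, s) = (A ^ (k : ℕ)).mulVec (B.col s) := by
      ext x
      simp [ctrbMatrix, Matrix.mul_apply, Matrix.mulVec, dotProduct]
    have hmod : (A ^ (k : ℕ)).mulVec (B.col s) =
        (aeval A (X ^ (k : ℕ) %ₘ p s)).mulVec (B.col s) := by
      have h1 := congrArg (aeval A) (modByMonic_add_div (X ^ (k : ℕ)) (p s))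
      rw [map_add, mul_comm, map_mul, map_pow, aeval_X] at h1
      rw [← h1, Matrix.add_mulVec, ← Matrix.mulVec_mulVec, h, Matrix.mulVec_zero, add_zero]
    rw [SetLike.mem_coe, hcol, hmod]
    by_cases h1 : p s = 1
    · rw [h1, modByMonic_one, map_zero, Matrix.zero_mulVec]
      exact Submodule.zero_mem _
    · rw [aeval_eq_sum_range' (natDegree_modByMonic_lt _ (hp s) h1), Matrix.sum_mulVec]
      refine Submodule.sum_mem _ fun i hi => ?_
      rw [Matrix.smul_mulVec]
      exact Submodule.smul_mem _ _ (Submodule.subset_span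
        ⟨⟨s, i, Finset.mem_range.1 hi⟩, rfl⟩)
  refine (Submodule.finrank_mono hle).trans ((finrank_range_le_card f).trans ?_)
  simp

end

/-- Counts the odd levels among `0, …, 2 * L`, each of which contributes one factor `X` to the
annihilator. -/
lemma sum_range_mod_two (L : ℕ) : ∑ l ∈ Finset.range (2 * L + 1), l % 2 = L := by
  induction L with
  | zero => simp
  | succ L ih =>
    rw [show 2 * (L + 1) + 1 = 2 * L + 1 + 1 + 1 by ring, Finset.sum_range_succ,
      Finset.sum_range_succ, ih]
    omega

/-! ### The lower bound -/

namespace Network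

variable {n m : ℕ} {G : Network n m}

open Polynomial in
/-- An annihilating polynomial of the column of an input. -/
lemma exists_annihilator {d : Fin n → ℕ} {S : Finset (Fin n)} {r : Fin n → Fin m} {h : Fin n → ℕ}
    (hedge : ∀ i j, G.edge j i → r i = r j ∧ h j + (if i ∈ S then 0 else 1) ≤ h i)
    (hinput : ∀ s i, G.input s i → r i = s) (hpos : ∀ i, (if i ∈ S then 0 else 1) ≤ h i)
    {A : Matrix (Σ i, Fin (d i)) (Σ i, Fin (d i)) ℝ} {B : Matrix (Σ i, Fin (d i)) (Fin m) ℝ}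
    (hA : IsRealization (G.extended d S).A A) (hB : IsRealization (G.extended d S).B B)
    (s : Fin m) :
    ∃ p : ℝ[X], p.Monic ∧ (aeval A p).mulVec (B.col s) = 0 ∧
      p.natDegree ≤ (Finset.univ.filter (r · = s)).sup h +
        (Finset.univ.filter fun x : Σ i, Fin (d i) => x.1 ∈ S ∧ r x.1 = s).card := by
  classical
  set L := (Finset.univ.filter (r · = s)).sup h with hL
  have hA' : ∀ x y, A x y ≠ 0 → (x.1 = y.1 ∧ x.1 ∈ S) ∨ G.edge y.1 x.1 := by
    intro x y hxy
    have h1 := hA x y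
    by_cases hxy1 : x.1 = y.1 <;> by_cases hxS : x.1 ∈ S <;> by_cases he : G.edge y.1 x.1 <;>
      simp_all [extended, Entry.Admits]
  have hB' : ∀ x, B x s ≠ 0 → G.input s x.1 := by
    intro x hx
    have h1 := hB x s
    by_contra he
    simp [extended, Entry.Admits, he] at h1
    exact hx h1
  -- Nodes outside `S` have positive height and get odd levels, just below the even level of the
  -- nodes of `S` with equal height. An edge between equal heights ends in `S`, so no edge lowers
  -- the level.
  set κ : (Σ i, Fin (d i)) → ℕ := fun x => if x.1 ∈ S then 2 * h x.1 else 2 * h x.1 - 1 with hκ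
  set q : ℕ → ℝ[X] := fun l => if l % 2 = 0 then
    (A.toSquareBlockProp fun x => r x.1 = s ∧ κ x = l).charpoly else X with hq
  have hmono : ∀ x y, A x y ≠ 0 → r y.1 = s → r x.1 = s ∧ κ y ≤ κ x := by
    intro x y hxy hy
    rcases hA' x y hxy with ⟨h1, h2⟩ | h1
    · exact ⟨by rw [h1, hy], by simp only [hκ, h1]; exact le_rfl⟩
    · refine ⟨by rw [(hedge _ _ h1).1, hy], ?_⟩
      have h2 := (hedge _ _ h1).2
      simp only [hκ]
      split_ifs at h2 ⊢ <;> omega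
  -- An odd level consists of nodes outside `S` of one height. An edge between two of them would
  -- raise the height and they have no internal dynamics, so the block vanishes.
  have hann : ∀ l, aeval (A.toSquareBlockProp fun x => r x.1 = s ∧ κ x = l) (q l) = 0 := by
    intro l
    by_cases hl : l % 2 = 0
    · simp only [hq, hl, if_true]
      exact Matrix.aeval_self_charpoly _
    · simp only [hq, hl, if_false, aeval_X]
      ext x y
      by_contra hxy
      have hx := x.2.2
      have hy := y.2.2
      have px := hpos x.1.1
      have py := hpos y.1.1
      simp only [hκ] at hx hy
      rcases hA' _ _ hxy with ⟨h1, h2⟩ | h1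
      · rw [if_pos h2] at hx
        omega
      · have h2 := (hedge _ _ h1).2
        split_ifs at hx hy h2 px py <;> omega
  have hmonic : ∀ l, (q l).Monic := by
    intro l
    simp only [hq]
    split_ifs
    · exact Matrix.charpoly_monic _
    · exact monic_X
  have hκL : ∀ x : Σ i, Fin (d i), r x.1 = s → κ x < 2 * L + 1 := by
    intro x hx
    have : h x.1 ≤ L := Finset.le_sup (f := h) (by simpa using hx)
    simp only [hκ]
    split_ifs <;> omega
  refine ⟨∏ l ∈ Finset.range (2 * L + 1), q l, monic_prod_of_monic _ _ fun l _ => hmonic l, ?_, ?_⟩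
  · ext x
    by_contra hx
    have := aeval_prod_mulVec_support A (fun x => r x.1 = s) κ hmono q hann (B.col s)
      (fun x hx => hinput _ _ (hB' x hx)) (2 * L + 1) x hx
    have := hκL x this.1
    omega
  · rw [natDegree_prod_of_monic _ _ fun l _ => hmonic l]
    rw [Finset.card_eq_sum_card_fiberwise (f := κ) (t := Finset.range (2 * L + 1))
      (fun x hx => by simpa using hκL x (Finset.mem_filter.1 (Finset.mem_coe.1 hx)).2.2)]
    refine le_of_le_of_eq ?_ (congrArg (· + _) (sum_range_mod_two L))
    rw [← Finset.sum_add_distrib]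
    refine Finset.sum_le_sum fun l _ => ?_
    simp only [hq]
    split_ifs with hl
    · rw [Matrix.charpoly_natDegree_eq_dim, hl, zero_add, Fintype.card_subtype]
      refine Finset.card_le_card fun x hx => ?_
      simp only [Finset.mem_filter, Finset.mem_univ, true_and] at hx ⊢
      refine ⟨⟨?_, hx.1⟩, hx.2⟩
      by_contra hS
      have h1 := hx.2
      have h2 := hpos x.1
      simp only [hκ, if_neg hS] at h1 h2
      omega
    · rw [natDegree_X]
      omega

/-- A count of the states that bounds the rank of the output controllability matrix. -/
lemma IsYNetwork.le_card_add_sum (hG : G.IsYNetwork) {Z : Finset (Fin n)}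
    (hZ : G.system.IsMaximumStemCovered Z) {d : Fin n → ℕ} {S : Finset (Fin n)}
    (h : (G.extended d S).IsStructurallyOutputControllable) : n ≤ Z.card + ∑ i ∈ S, d i := by
  classical
  obtain ⟨A, B, C, hA, hB, -, hrank⟩ := h
  obtain ⟨r, hr⟩ := hG.exists_root
  set w : Fin n → ℕ := fun i => if i ∈ S then 0 else 1 with hw
  have hinput : ∀ s i, G.input s i → r i = s := by
    intro s i hsi
    have := hr _ (isStem_pair hsi) i (by simp)
    simpa using this.symm
  have hedge : ∀ i j, G.edge j i → r i = r j ∧ G.height w j + w i ≤ G.height w i := by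
    intro i j hji
    refine ⟨?_, hG.height_add_le w hji⟩
    obtain ⟨p, hp, hj⟩ := hG.1 j
    have h1 := hr _ (hG.isStem_append hp hj hji)
    have h2 := (h1 i (by simp)).symm.trans (h1 j (by simp [List.mem_of_getLast? hj]))
    simpa using h2
  choose p hmonic hp hdeg using exists_annihilator hedge hinput (hG.le_height w) hA hB
  have hle := (Matrix.rank_mul_le_right C (ctrbMatrix A B)).trans (rank_ctrbMatrix_le A B p hmonic hp)
  rw [hrank, Fintype.card_fin] at hle
  refine hle.trans ((Finset.sum_le_sum fun s _ => hdeg s).trans ?_)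
  rw [Finset.sum_add_distrib]
  refine add_le_add (hG.sum_sup_height_le hZ hr S) (le_of_eq ?_)
  have : ∑ i ∈ S, d i =
      (Finset.univ.filter fun x : Σ i, Fin (d i) => x.1 ∈ S).card := by
    have h1 : (Finset.univ.filter fun x : Σ i, Fin (d i) => x.1 ∈ S) =
        S.sigma fun _ => Finset.univ := by ext; simp
    rw [h1, Finset.card_sigma]
    simp
  rw [this, Finset.card_eq_sum_card_fiberwise (f := fun x => r x.1) (t := Finset.univ)
    (fun _ _ => Finset.mem_coe.2 (Finset.mem_univ _))]
  simp only [Finset.filter_filter]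

end Network

/-! ### Reduction of the upper bound to a first-order network with self-loops -/

namespace Network

variable {n m : ℕ} {G : Network n m}

lemma sum_sigma_fin_zero {d : Fin n → ℕ} (hd : ∀ i, 0 < d i) (f : Fin n → ℝ) :
    ∑ y : Σ i, Fin (d i), (if (y.2 : ℕ) = 0 then f y.1 else 0) = ∑ i, f i := by
  rw [Fintype.sum_sigma]
  refine Finset.sum_congr rfl fun i _ => ?_
  rw [Finset.sum_eq_single ⟨0, hd i⟩]
  · simp
  · intro b _ hb
    rw [if_neg]
    intro h
    exact hb (Fin.ext h)
  · simp

/-- If the first-order network with self-loops at the nodes of `S` has a controllable realization,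
the extended system is structurally output controllable. -/
lemma isStructurallyOutputControllable_extended {d : Fin n → ℕ} (hd : ∀ i, 0 < d i)
    {S : Finset (Fin n)} (A : Matrix (Fin n) (Fin n) ℝ) (B : Matrix (Fin n) (Fin m) ℝ)
    (hA : ∀ i j, A i j ≠ 0 → (i = j ∧ i ∈ S) ∨ G.edge j i) (hB : ∀ i s, B i s ≠ 0 → G.input s i)
    (h : ∀ w : Fin n → ℝ, (∀ (k : ℕ) (s : Fin m), ∑ i, w i * (A ^ k * B) i s = 0) → ∀ i, w i = 0) :
    (G.extended d S).IsStructurallyOutputControllable := by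
  classical
  -- Only the state of index `0` in each subsystem is active; the others are isolated and carry
  -- output weight zero.
  set A' : Matrix (Σ i, Fin (d i)) (Σ i, Fin (d i)) ℝ := Matrix.of fun x y =>
    if (x.2 : ℕ) = 0 ∧ (y.2 : ℕ) = 0 then A x.1 y.1 else 0 with hA'
  set B' : Matrix (Σ i, Fin (d i)) (Fin m) ℝ := Matrix.of fun x s =>
    if (x.2 : ℕ) = 0 then B x.1 s else 0 with hB'
  set C' : Matrix (Fin n) (Σ i, Fin (d i)) ℝ := Matrix.of fun i x =>
    if (x.2 : ℕ) = 0 then (if i = x.1 then 1 else 0) else 0 with hC'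
  have hpow : ∀ (k : ℕ) (x : Σ i, Fin (d i)) (s : Fin m), (A' ^ k * B') x s = if (x.2 : ℕ) = 0 then (A ^ k * B) x.1 s else 0 := by
    intro k
    induction k with
    | zero => intro x s; simp [hB']
    | succ k ih =>
      intro x s
      rw [pow_succ', Matrix.mul_assoc, Matrix.mul_apply, pow_succ', Matrix.mul_assoc]
      split_ifs with hx
      · rw [Matrix.mul_apply, ← sum_sigma_fin_zero hd]
        refine Finset.sum_congr rfl fun y _ => ?_
        rw [ih]
        by_cases hy : (y.2 : ℕ) = 0 <;> simp [hA', hx, hy]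
      · refine Finset.sum_eq_zero fun y _ => ?_
        simp [hA', hx]
  refine ⟨A', B', C', ?_, ?_, ?_, ?_⟩
  · intro x y
    by_cases h0 : A x.1 y.1 = 0
    · have h1 : A' x y = 0 := by simp [hA', h0]
      by_cases hxy : x.1 = y.1 <;> by_cases hyS : y.1 ∈ S <;> by_cases he : G.edge y.1 x.1 <;>
        simp [extended, Entry.Admits, h1, hxy, hyS, he]
    · rcases hA _ _ h0 with ⟨hxy, hxS⟩ | he
      · simp [extended, Entry.Admits, hxy, hxy ▸ hxS]
      · have hxy : x.1 ≠ y.1 := fun h => G.loopless _ (h ▸ he)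
        simp [extended, Entry.Admits, hxy, he]
  · intro x s
    by_cases h0 : B x.1 s = 0
    · have h1 : B' x s = 0 := by simp [hB', h0]
      by_cases he : G.input s x.1 <;> simp [extended, Entry.Admits, h1, he]
    · simp [extended, Entry.Admits, hB _ _ h0]
  · intro i x
    by_cases hi : i = x.1
    · subst hi
      by_cases h1 : d x.1 = 1
      · have h2 : (x.2 : ℕ) = 0 := by have := x.2.2; omega
        simp [extended, Entry.Admits, hC', h1, h2]
      · simp [extended, Entry.Admits, h1]
    · simp [extended, Entry.Admits, hC', hi]
  · have hM : ∀ i k s, (C' * ctrbMatrix A' B') i (k, s) = (A ^ (k : ℕ) * B) i s := by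
      intro i k s
      rw [Matrix.mul_apply]
      have : ∀ x, C' i x * ctrbMatrix A' B' x (k, s) =
          if (x.2 : ℕ) = 0 then (if i = x.1 then (A ^ (k : ℕ) * B) x.1 s else 0) else 0 := by
        intro x
        simp only [ctrbMatrix, Matrix.of_apply, hpow, hC']
        split_ifs <;> simp
      simp_rw [this]
      rw [sum_sigma_fin_zero hd fun j => if i = j then (A ^ (k : ℕ) * B) j s else 0]
      simp
    refine LinearIndependent.rank_matrix (Fintype.linearIndependent_iff.2 fun w hw i₀ => ?_)
    have hn : n ≤ Fintype.card (Σ i, Fin (d i)) := by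
      rw [Fintype.card_sigma]
      calc n = ∑ i : Fin n, 1 := by simp
        _ ≤ ∑ i, Fintype.card (Fin (d i)) := Finset.sum_le_sum fun i _ => by
          rw [Fintype.card_fin]; exact hd i
    -- The controllability matrix of the extended system has enough columns for all times below `n`.
    -- Reduction modulo the characteristic polynomial of the small matrix `A` extends the relation
    -- to all times.
    have hsmall : ∀ k < n, ∀ s, ∑ i, w i * (A ^ k * B) i s = 0 := by
      intro k hk s
      have := congrFun hw (⟨k, hk.trans_le hn⟩, s)
      simpa [Finset.sum_apply, Matrix.row, hM] using this
    refine h w (fun k s => ?_) i₀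
    have hne : A.charpoly ≠ 1 := by
      intro h1
      have := A.charpoly_natDegree_eq_dim
      rw [h1, Polynomial.natDegree_one, Fintype.card_fin] at this
      exact absurd i₀.2 (by omega)
    rw [A.pow_eq_aeval_mod_charpoly, Polynomial.aeval_eq_sum_range' (n := n), Matrix.sum_mul]
    · simp only [Matrix.sum_apply, Finset.mul_sum, Matrix.smul_mul, Matrix.smul_apply, smul_eq_mul]
      rw [Finset.sum_comm]
      refine Finset.sum_eq_zero fun l hl => ?_
      simp only [mul_left_comm (w _), ← Finset.mul_sum]
      rw [hsmall l (Finset.mem_range.1 hl), mul_zero]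
    · have := Polynomial.natDegree_modByMonic_lt (Polynomial.X ^ k) A.charpoly_monic hne
      rwa [A.charpoly_natDegree_eq_dim, Fintype.card_fin] at this

/-- The height with unit weights increases along edges; multiplying it by `n` and adding the index
`i < n` breaks ties without disturbing the order. -/
lemma IsYNetwork.exists_rank (hG : G.IsYNetwork) :
    ∃ ρ : Fin n → ℕ, Function.Injective ρ ∧ (∀ i, 0 < ρ i) ∧ ∀ i j, G.edge j i → ρ j < ρ i := by
  have hlt : ∀ i j : Fin n, G.height (fun _ => 1) j + 1 ≤ G.height (fun _ => 1) i →
      G.height (fun _ => 1) j * n + j < G.height (fun _ => 1) i * n + i := by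
    intro i j h
    have := Nat.mul_le_mul_right n h
    have := j.2
    nlinarith
  refine ⟨fun i => G.height (fun _ => 1) i * n + i, ?_, ?_, ?_⟩
  · intro i j hij
    rcases lt_trichotomy (G.height (fun _ => 1) i) (G.height (fun _ => 1) j) with h | h | h
    · exact absurd hij (hlt j i h).ne
    · simp only [h] at hij
      exact Fin.ext (by omega)
    · exact absurd hij (hlt i j h).ne'
  · intro i
    have h1 := hG.le_height (fun _ => 1) i
    have h2 := i.2
    exact Nat.add_pos_left (Nat.mul_pos h1 (by omega)) _
  · intro i j h
    exact hlt i j (hG.height_add_le (fun _ => 1) h)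

/-- A function of growth rate at least `l` with nonzero coefficient is not dominated by a function
of growth rate at most `l - 1`. -/
lemma eq_zero_of_mul_pow_le {a W l : ℝ} (hl : 1 ≤ l) (ha : 0 ≤ a) (k₀ : ℕ)
    (h : ∀ k, a * l ^ k ≤ W * (l - 1) ^ (k₀ + k)) : a = 0 := by
  have hl0 : 0 < l := by linarith
  have htend : Filter.Tendsto (fun k : ℕ => W * (l - 1) ^ k₀ * ((l - 1) / l) ^ k) Filter.atTop
      (nhds (W * (l - 1) ^ k₀ * 0)) :=
    (tendsto_pow_atTop_nhds_zero_of_lt_one (div_nonneg (by linarith) hl0.le)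
      ((div_lt_one hl0).2 (by linarith))).const_mul _
  refine le_antisymm ?_ ha
  rw [mul_zero] at htend
  refine ge_of_tendsto' htend fun k => ?_
  rw [div_pow, ← mul_div_assoc, le_div_iff₀ (pow_pos hl0 k), mul_assoc W, ← pow_add]
  exact h k

/-! ### The realization with shifts on `Z` and separated growth rates outside -/

open Classical in
/-- The state matrix with unit weights that uses only the paths inside of `Z`, all edges towards
nodes outside `Z`, and self-loops of weight `(n + 1) ρ i` at these. -/
noncomputable def pathMatrix (G : Network n m) (Z : Finset (Fin n)) (r : Fin n → Fin m)
    (t ρ : Fin n → ℕ) : Matrix (Fin n) (Fin n) ℝ :=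
  Matrix.of fun i j =>
    if i ∈ Z then (if j ∈ Z ∧ r j = r i ∧ t i = t j + 1 then 1 else 0)
    else (if i = j then ((n : ℝ) + 1) * ρ i else if G.edge j i then 1 else 0)

open Classical in
/-- The input matrix with unit weights that uses only the first edges of the paths inside of `Z` and
all edges towards nodes outside `Z`. -/
noncomputable def pathInput (G : Network n m) (Z : Finset (Fin n)) (r : Fin n → Fin m)
    (t : Fin n → ℕ) : Matrix (Fin n) (Fin m) ℝ :=
  Matrix.of fun i s =>
    if i ∈ Z then (if t i = 0 ∧ r i = s then 1 else 0) else if G.input s i then 1 else 0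

section Path

variable {Z : Finset (Fin n)} {r : Fin n → Fin m} {t ρ : Fin n → ℕ}

open Classical in
lemma pathMatrix_apply (i j : Fin n) : G.pathMatrix Z r t ρ i j =
    if i ∈ Z then (if j ∈ Z ∧ r j = r i ∧ t i = t j + 1 then 1 else 0)
    else (if i = j then ((n : ℝ) + 1) * ρ i else if G.edge j i then 1 else 0) := rfl

open Classical in
lemma pathInput_apply (i : Fin n) (s : Fin m) : G.pathInput Z r t i s =
    if i ∈ Z then (if t i = 0 ∧ r i = s then 1 else 0) else if G.input s i then 1 else 0 := rfl

lemma pathMatrix_nonneg (i j : Fin n) : 0 ≤ G.pathMatrix Z r t ρ i j := by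
  rw [pathMatrix_apply]
  split_ifs <;> positivity

lemma pathMatrix_pow_mul_succ (k : ℕ) (i : Fin n) (s : Fin m) :
    (G.pathMatrix Z r t ρ ^ (k + 1) * G.pathInput Z r t) i s =
      ∑ j, G.pathMatrix Z r t ρ i j * (G.pathMatrix Z r t ρ ^ k * G.pathInput Z r t) j s := by
  rw [pow_succ', Matrix.mul_assoc, Matrix.mul_apply]

lemma pathMatrix_pow_mul_nonneg (k : ℕ) (i : Fin n) (s : Fin m) :
    0 ≤ (G.pathMatrix Z r t ρ ^ k * G.pathInput Z r t) i s := by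
  induction k generalizing i with
  | zero =>
    rw [pow_zero, Matrix.one_mul, pathInput_apply]
    split_ifs <;> norm_num
  | succ k ih =>
    rw [pathMatrix_pow_mul_succ]
    exact Finset.sum_nonneg fun j _ => mul_nonneg (pathMatrix_nonneg i j) (ih j)

lemma le_pathMatrix_pow_mul_succ (k : ℕ) (i j : Fin n) (s : Fin m) :
    G.pathMatrix Z r t ρ i j * (G.pathMatrix Z r t ρ ^ k * G.pathInput Z r t) j s ≤
      (G.pathMatrix Z r t ρ ^ (k + 1) * G.pathInput Z r t) i s := by
  rw [pathMatrix_pow_mul_succ]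
  exact Finset.single_le_sum (f := fun j => G.pathMatrix Z r t ρ i j *
    (G.pathMatrix Z r t ρ ^ k * G.pathInput Z r t) j s)
    (fun j _ => mul_nonneg (pathMatrix_nonneg i j) (pathMatrix_pow_mul_nonneg k j s))
    (Finset.mem_univ j)

/-- `Z` receives nothing from outside, and within it every stem is a shift: an impulse at the input
passes the node at position `k` at time `k` and never returns. -/
lemma pathMatrix_pow_mul_of_mem (hinj : ∀ i ∈ Z, ∀ j ∈ Z, r i = r j → t i = t j → i = j)
    (hpred : ∀ j ∈ Z, ∀ k, t j = k + 1 → ∃ i ∈ Z, r i = r j ∧ t i = k ∧ G.edge i j)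
    (k : ℕ) {i : Fin n} (hi : i ∈ Z) (s : Fin m) :
    (G.pathMatrix Z r t ρ ^ k * G.pathInput Z r t) i s =
      if t i = k ∧ r i = s then 1 else 0 := by
  induction k generalizing i with
  | zero => simp [pathInput_apply, hi]
  | succ k ih =>
    rw [pathMatrix_pow_mul_succ]
    split_ifs with h
    · obtain ⟨j, hj, hrj, htj, -⟩ := hpred i hi k h.1
      rw [Finset.sum_eq_single j]
      · rw [ih hj, if_pos ⟨htj, hrj.trans h.2⟩]
        simp [pathMatrix_apply, hi, hj, hrj, htj, h.1]
      · intro l _ hl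
        rw [pathMatrix_apply, if_pos hi, if_neg, zero_mul]
        rintro ⟨hlZ, hrl, htl⟩
        exact hl (hinj l hlZ j hj (hrl.trans hrj.symm) (by omega))
      · simp
    · refine Finset.sum_eq_zero fun j _ => ?_
      rw [pathMatrix_apply, if_pos hi]
      split_ifs with hj
      · rw [ih hj.1, if_neg, mul_zero]
        rintro ⟨h1, h2⟩
        exact h ⟨by omega, by rw [← hj.2.1, h2]⟩
      · rw [zero_mul]

/-- Outside `Z`, the row of `i` has its self-loop and at most `n` unit entries, which come from
nodes of smaller rank and hence of smaller growth. The base is thus a bound on the row sum. -/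
lemma pathMatrix_pow_mul_le (hinj : ∀ i ∈ Z, ∀ j ∈ Z, r i = r j → t i = t j → i = j)
    (hpred : ∀ j ∈ Z, ∀ k, t j = k + 1 → ∃ i ∈ Z, r i = r j ∧ t i = k ∧ G.edge i j)
    (hρ : ∀ i j, G.edge j i → ρ j < ρ i) (k : ℕ) (i : Fin n) (s : Fin m) :
    (G.pathMatrix Z r t ρ ^ k * G.pathInput Z r t) i s ≤ (((n : ℝ) + 1) * ρ i + n) ^ k := by
  have hn : (1 : ℝ) ≤ n := by exact_mod_cast i.pos
  induction k generalizing i with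
  | zero =>
    rw [pow_zero, Matrix.one_mul, pathInput_apply]
    split_ifs <;> norm_num
  | succ k ih =>
    by_cases hi : i ∈ Z
    · rw [pathMatrix_pow_mul_of_mem hinj hpred _ hi]
      have h1 : (1 : ℝ) ≤ (((n : ℝ) + 1) * ρ i + n) ^ (k + 1) :=
        one_le_pow₀ (le_add_of_nonneg_of_le (by positivity) hn)
      split_ifs
      · exact h1
      · linarith
    · rw [pathMatrix_pow_mul_succ]
      have hterm : ∀ j, G.pathMatrix Z r t ρ i j *
          (G.pathMatrix Z r t ρ ^ k * G.pathInput Z r t) j s ≤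
          ((if i = j then ((n : ℝ) + 1) * ρ i else 0) + 1) *
            (((n : ℝ) + 1) * ρ i + n) ^ k := by
        intro j
        have hpos : (0 : ℝ) ≤ (((n : ℝ) + 1) * ρ i + n) ^ k := by positivity
        rw [pathMatrix_apply, if_neg hi]
        split_ifs with h1 h2
        · subst h1
          exact mul_le_mul (by linarith) (ih i) (pathMatrix_pow_mul_nonneg k i s) (by positivity)
        · rw [one_mul, zero_add, one_mul]
          refine (ih j).trans (pow_le_pow_left₀ (by positivity) ?_ k)
          have : (ρ j : ℝ) ≤ ρ i := by exact_mod_cast (hρ i j h2).le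
          gcongr
        · simpa using hpos
      refine (Finset.sum_le_sum fun j _ => hterm j).trans (le_of_eq ?_)
      rw [← Finset.sum_mul, Finset.sum_add_distrib, pow_succ']
      simp

lemma IsYNetwork.exists_one_le_pathMatrix_pow_mul (hG : G.IsYNetwork)
    (hinj : ∀ i ∈ Z, ∀ j ∈ Z, r i = r j → t i = t j → i = j)
    (hpred : ∀ j ∈ Z, ∀ k, t j = k + 1 → ∃ i ∈ Z, r i = r j ∧ t i = k ∧ G.edge i j)
    (hρ : ∀ i j, G.edge j i → ρ j < ρ i) (i : Fin n) :
    ∃ (k : ℕ) (s : Fin m), 1 ≤ (G.pathMatrix Z r t ρ ^ k * G.pathInput Z r t) i s := by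
  induction h : ρ i using Nat.strong_induction_on generalizing i with
  | _ N ih =>
    by_cases hi : i ∈ Z
    · exact ⟨t i, r i, by simp [pathMatrix_pow_mul_of_mem hinj hpred _ hi]⟩
    · rcases hG.exists_predecessor i with ⟨s, hs⟩ | ⟨j, hj⟩
      · exact ⟨0, s, by simp [pathInput_apply, hi, hs]⟩
      · obtain ⟨k, s, hk⟩ := ih (ρ j) (h ▸ hρ i j hj) j rfl
        refine ⟨k + 1, s, le_trans ?_ (le_pathMatrix_pow_mul_succ k i j s)⟩
        have hne : i ≠ j := by
          rintro rfl
          exact G.loopless i hj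
        simpa [pathMatrix_apply, hi, hne, hj] using hk

/-- Once `i` has been reached, its self-loop alone multiplies the response by its weight at every
step, and nothing cancels since all entries are nonnegative. -/
lemma pow_le_pathMatrix_pow_mul {i : Fin n} (hi : i ∉ Z) {k₀ : ℕ} {s : Fin m}
    (h : 1 ≤ (G.pathMatrix Z r t ρ ^ k₀ * G.pathInput Z r t) i s) (k : ℕ) :
    (((n : ℝ) + 1) * ρ i) ^ k ≤ (G.pathMatrix Z r t ρ ^ (k₀ + k) * G.pathInput Z r t) i s := by
  induction k with
  | zero => simpa using h
  | succ k ih =>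
    refine le_trans ?_ (le_pathMatrix_pow_mul_succ (k₀ + k) i i s)
    rw [pow_succ', pathMatrix_apply, if_neg hi, if_pos rfl]
    exact mul_le_mul_of_nonneg_left ih (by positivity)

/-- The realization by `pathMatrix` and `pathInput` is controllable. -/
lemma IsYNetwork.eq_zero_of_sum_mul_pathMatrix_pow (hG : G.IsYNetwork)
    (hinj : ∀ i ∈ Z, ∀ j ∈ Z, r i = r j → t i = t j → i = j)
    (hpred : ∀ j ∈ Z, ∀ k, t j = k + 1 → ∃ i ∈ Z, r i = r j ∧ t i = k ∧ G.edge i j)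
    (hρinj : Function.Injective ρ) (hρpos : ∀ i, 0 < ρ i) (hρ : ∀ i j, G.edge j i → ρ j < ρ i)
    (w : Fin n → ℝ)
    (hw : ∀ (k : ℕ) (s : Fin m), ∑ i, w i * (G.pathMatrix Z r t ρ ^ k * G.pathInput Z r t) i s = 0)
    (i : Fin n) : w i = 0 := by
  have hout : ∀ i, i ∉ Z → w i = 0 := by
    by_contra! hne
    obtain ⟨i', hi', hwi'⟩ := hne
    -- Among the nodes outside `Z` with nonzero coefficient, the one of largest rank grows fastest
    -- and cannot be balanced by the rest.
    obtain ⟨i, hi, hmax⟩ := Finset.exists_max_image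
      (Finset.univ.filter fun i => i ∉ Z ∧ w i ≠ 0) ρ ⟨i', by simp [hi', hwi']⟩
    simp only [Finset.mem_filter, Finset.mem_univ, true_and] at hi hmax
    obtain ⟨hiZ, hwi⟩ := hi
    have hn : (1 : ℝ) ≤ n := by exact_mod_cast i.pos
    have hρ1 : (1 : ℝ) ≤ ρ i := by exact_mod_cast hρpos i
    have hl : 2 ≤ ((n : ℝ) + 1) * ρ i := by nlinarith
    obtain ⟨k₀, s, hk₀⟩ := hG.exists_one_le_pathMatrix_pow_mul hinj hpred hρ i
    refine hwi (abs_eq_zero.1 (eq_zero_of_mul_pow_le (W := ∑ j, |w j|) (le_trans one_le_two hl)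
      (abs_nonneg _) k₀ fun k => (mul_le_mul_of_nonneg_left
        (pow_le_pathMatrix_pow_mul hiZ hk₀ k) (abs_nonneg _)).trans ?_))
    have hsum := hw (k₀ + k) s
    rw [← Finset.add_sum_erase _ _ (Finset.mem_univ i), add_eq_zero_iff_eq_neg] at hsum
    rw [← abs_of_nonneg (pathMatrix_pow_mul_nonneg (k₀ + k) i s), ← abs_mul, hsum, abs_neg]
    refine (Finset.abs_sum_le_sum_abs _ _).trans ?_
    rw [Finset.sum_mul]
    refine (Finset.sum_le_sum fun j hj => ?_).trans
      (Finset.sum_le_sum_of_subset_of_nonneg (Finset.erase_subset i _) fun j _ _ =>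
        mul_nonneg (abs_nonneg _) (pow_nonneg (by linarith) _))
    rw [abs_mul, abs_of_nonneg (pathMatrix_pow_mul_nonneg _ _ _)]
    by_cases hwj : w j = 0
    · simp [hwj]
    refine mul_le_mul_of_nonneg_left ?_ (abs_nonneg _)
    by_cases hjZ : j ∈ Z
    · rw [pathMatrix_pow_mul_of_mem hinj hpred _ hjZ]
      have h1 : (1 : ℝ) ≤ (((n : ℝ) + 1) * ρ i - 1) ^ (k₀ + k) := one_le_pow₀ (by linarith)
      split_ifs
      · exact h1
      · linarith
    · refine (pathMatrix_pow_mul_le hinj hpred hρ _ j s).trans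
        (pow_le_pow_left₀ (by positivity) ?_ _)
      -- The factor `n + 1` in the self-loop weights is chosen for this gap: `ρ j ≤ ρ i - 1` gives
      -- `(n + 1) * ρ j + n ≤ (n + 1) * ρ i - 1`.
      have hlt : ρ j + 1 ≤ ρ i :=
        lt_of_le_of_ne (hmax j ⟨hjZ, hwj⟩) fun h => (Finset.mem_erase.1 hj).1 (hρinj h)
      have hlt' : (ρ j : ℝ) + 1 ≤ ρ i := by exact_mod_cast hlt
      nlinarith
  by_cases hi : i ∈ Z
  -- At time `t i`, input `r i` excites no node of `Z` other than `i`.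
  · have h := hw (t i) (r i)
    rw [Finset.sum_eq_single i] at h
    · simpa [pathMatrix_pow_mul_of_mem hinj hpred _ hi] using h
    · intro j _ hj
      by_cases hjZ : j ∈ Z
      · rw [pathMatrix_pow_mul_of_mem hinj hpred _ hjZ, if_neg, mul_zero]
        exact fun h => hj (hinj j hjZ i hi h.2 h.1)
      · rw [hout j hjZ, zero_mul]
    · simp
  · exact hout i hi

end Path

/-- Replacing the nodes outside a maximum set covered by disjoint stems suffices for structural
output controllability. -/
lemma IsYNetwork.isStructurallyOutputControllable_extended_compl (hG : G.IsYNetwork)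
    {Z : Finset (Fin n)} (hZ : G.system.IsMaximumStemCovered Z) {d : Fin n → ℕ}
    (hd : ∀ i, 0 < d i) : (G.extended d Zᶜ).IsStructurallyOutputControllable := by
  obtain ⟨r, hr⟩ := hG.exists_root
  obtain ⟨t, hinj, hzero, hpred⟩ := exists_stem_position hZ hr
  obtain ⟨ρ, hρinj, hρpos, hρ⟩ := hG.exists_rank
  refine isStructurallyOutputControllable_extended hd (G.pathMatrix Z r t ρ) (G.pathInput Z r t)
    ?_ ?_ (hG.eq_zero_of_sum_mul_pathMatrix_pow hinj hpred hρinj hρpos hρ)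
  · intro i j hij
    rw [pathMatrix_apply] at hij
    split_ifs at hij with hi h h h
    -- `pathMatrix` records only consecutive positions on a stem; the actual predecessor `l` has the
    -- same root and position as `j`, so the two coincide and the edge exists.
    · obtain ⟨l, hl, hrl, htl, hel⟩ := hpred i hi _ h.2.2
      rw [← hinj l hl j h.1 (hrl.trans h.2.1.symm) htl]
      exact Or.inr hel
    · exact absurd rfl hij
    · exact Or.inl ⟨h, by simpa using hi⟩
    · exact Or.inr h
    · exact absurd rfl hij
  · intro i s his
    rw [pathInput_apply] at his
    split_ifs at his with hi h h
    · rw [← h.2]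
      exact hzero i hi h.1
    · exact absurd rfl his
    · exact h
    · exact absurd rfl his

end Network

/-! ### Conclusion -/

namespace Network

lemma sum_orders_le {n : ℕ} (ν : Fin n → ℕ) (S : Finset (Fin n)) {N : ℕ}
    (h : ∀ i ∈ S, orders ν S i ≤ N) : ∑ i ∈ S, orders ν S i ≤ S.card * N := by
  simpa using Finset.sum_le_card_nsmul S _ N h

end Network

lemma sub_div_le_of_le_add_mul {n z k N : ℕ} (h : n ≤ z + k * N) :
    ((n : ℝ) - (z : ℝ)) / (N : ℝ) ≤ (k : ℝ) := by
  refine div_le_of_le_mul₀ (Nat.cast_nonneg _) (Nat.cast_nonneg _) ?_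
  have : (n : ℝ) ≤ z + k * N := by exact_mod_cast h
  linarith

theorem theorem3 {n m : ℕ} (G : Network n m) (hG : G.IsYNetwork)
    (Z : Finset (Fin n)) (hZ : G.system.IsMaximumStemCovered Z)
    (ν : Fin n → ℕ) (hν : ∀ i, 2 ≤ ν i) :
    (∃ Smin : ℕ,
      IsLeast {k : ℕ | ∃ S : Finset (Fin n), S.card = k ∧ G.ControllableAfterReplacing ν S} Smin ∧
      ((n : ℝ) - (Z.card : ℝ)) / ((Finset.univ.sup ν : ℕ) : ℝ) ≤ (Smin : ℝ) ∧
      (Smin : ℝ) ≤ (n : ℝ) - (Z.card : ℝ)) ∧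
    ∀ S : Finset (Fin n), G.ControllableAfterReplacing ν S →
      ((n : ℝ) - (Z.card : ℝ)) / ((Finset.univ.sup (Network.orders ν S) : ℕ) : ℝ) ≤
        (S.card : ℝ) := by
  have hbound : ∀ S : Finset (Fin n), G.ControllableAfterReplacing ν S →
      n ≤ Z.card + ∑ i ∈ S, Network.orders ν S i := fun S hS => hG.le_card_add_sum hZ hS
  have hcompl : G.ControllableAfterReplacing ν Zᶜ :=
    hG.isStructurallyOutputControllable_extended_compl hZ fun i => by
      have := hν i
      unfold Network.orders
      split_ifs <;> omega
  refine ⟨?_, fun S hS => sub_div_le_of_le_add_mul ((hbound S hS).trans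
    (Nat.add_le_add_left (Network.sum_orders_le ν S fun i _ =>
      Finset.le_sup (Finset.mem_univ i)) _))⟩
  have hne : {k : ℕ | ∃ S : Finset (Fin n), S.card = k ∧
      G.ControllableAfterReplacing ν S}.Nonempty := ⟨_, Zᶜ, rfl, hcompl⟩
  refine ⟨sInf _, ⟨Nat.sInf_mem hne, fun k hk => Nat.sInf_le hk⟩, ?_, ?_⟩
  · obtain ⟨S, hcard, hS⟩ := Nat.sInf_mem hne
    rw [← hcard]
    refine sub_div_le_of_le_add_mul ((hbound S hS).trans
      (Nat.add_le_add_left (Network.sum_orders_le ν S fun i hi => ?_) _))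
    rw [Network.orders, if_pos hi]
    exact Finset.le_sup (Finset.mem_univ i)
  · have h1 : sInf {k : ℕ | ∃ S : Finset (Fin n), S.card = k ∧
        G.ControllableAfterReplacing ν S} ≤ Zᶜ.card := Nat.sInf_le ⟨Zᶜ, rfl, hcompl⟩
    have h2 : Zᶜ.card + Z.card = n := by
      rw [add_comm, Finset.card_add_card_compl, Fintype.card_fin]
    rw [← eq_sub_of_add_eq (show (Zᶜ.card : ℝ) + Z.card = n by exact_mod_cast h2)]
    exact_mod_cast h1
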